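/- **Definitions.** Alphabets are finite sets. Let $x$ be an infinite sequence $x(0)x(1)x(2)\dots$ over a finite alphabet; $x[k,\infty)$ denotes its suffix $x(k)x(k+1)\dots$. The sequence $x$ is *almost periodic* if for every nonempty word $u$ occurring in $x$ there is $l$ such that $u$ occurs inside every segment of $x$ of length $l$; it is *generalized almost periodic* if this holds for every nonempty word $u$ occurring infinitely often in $x$. For a generalized almost periodic $x$, the *regulator* $r_x(n)$ is the least $l$ such that every word of length $n$ that occurs infinitely often in $x$ occurs inside every segment of $x$ of length $l$, and no word of length $n$ that occurs only finitely often in $x$ occurs in $x[l,\infty)$. The sequence $x$ is *linearly almost periodic* if it is almost periodic and there is a real $C\ge 1$ with $r_x(n)\le Cn$ for all $n$; it is *eventually linearly almost periodic* if some suffix of it is linearly almost periodic. A *finite-state transducer* $M$ consists of finite input and output alphabets $A,B$, a finite set $Q$ of states with an initial state $\tilde q$, an output function $\lambda:Q\times A\to B^*$ and a transition function $\mu:Q\times A\to Q$. For $x\in A^{\mathbb N}$ put $p_0=\tilde q$, $p_{n+1}=\mu(p_n,x(n))$; the image is the concatenation $M(x)=\lambda(p_0,x(0))\,\lambda(p_1,x(1))\,\lambda(p_2,x(2))\cdots$.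 The transducer is *uniform* if all words $\lambda(q,a)$ have length $1$. **Theorem.** Let $M$ be a finite-state transducer with $m$ states, and let $x$ be an eventually linearly almost periodic sequence over its input alphabet such that $M(x)$ is infinite. Then $M(x)$ is eventually linearly almost periodic. Moreover, suppose $M$ is uniform, and let $k\in\mathbb N$ and $C\ge 1$ be such that $x[k,\infty)$ is almost periodic with $r_{x[k,\infty)}(n)\le Cn$ for all $n$. Then $M(x)[k,\infty)$ is generalized almost periodic with $$r_{M(x)[k,\infty)}(n)\le C^{2m}n+C^{2m-1}+C^{2m-2}+\dots+C+1\quad\text{for all } n,$$ and there is $k'\ge k$ such that $M(x)[k',\infty)$ is almost periodic and $r_{M(x)[k',\infty)}(n)$ satisfies the same bound for all $n$. (In particular, for $k=0$ the bound holds for $r_{M(x)}$ itself.) -/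

import Mathlib

/-! Sequences over an alphabet `A` are functions `ℕ → A`, finite words are lists. -/

namespace AlmostPeriodic

section Sequences

variable {A : Type*}

/-- The suffix `x[k, ∞)`. -/
def suffix (x : ℕ → A) (k : ℕ) : ℕ → A := fun i => x (k + i)

/-- The word `x(i) x(i+1) ⋯ x(i+n-1)` of length `n`. -/
def factor (x : ℕ → A) (i n : ℕ) : List A := List.ofFn fun j : Fin n => x (i + j)

/-- The word `u` occurs in `x` at position `i`. -/
def OccursAt (x : ℕ → A) (u : List A) (i : ℕ) : Prop := factor x i u.length = u

/-- The word `u` has an occurrence inside the segment of `x` of length `l` that starts at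
position `i`, that is, inside `[i, i + l - 1]`. -/
def OccursWithin (x : ℕ → A) (u : List A) (i l : ℕ) : Prop :=
  ∃ j, i ≤ j ∧ j + u.length ≤ i + l ∧ OccursAt x u j

/-- The word `u` occurs in `x` infinitely many times. -/
def OccursInfinitely (x : ℕ → A) (u : List A) : Prop := {i | OccursAt x u i}.Infinite

/-- `x` is almost periodic (uniformly recurrent). -/
def IsAP (x : ℕ → A) : Prop :=
  ∀ u : List A, u ≠ [] → (∃ i, OccursAt x u i) → ∃ l, ∀ i, OccursWithin x u i l

/-- `x` is generalized almost periodic. -/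
def IsGAP (x : ℕ → A) : Prop :=
  ∀ u : List A, u ≠ [] → OccursInfinitely x u → ∃ l, ∀ i, OccursWithin x u i l

/-- The lengths `l` such that every word of length `n` occurring infinitely often in `x` occurs
inside every segment of length `l`, and no other word of length `n` occurs in `x[l, ∞)`. -/
def regulatorSet (x : ℕ → A) (n : ℕ) : Set ℕ :=
  {l | ∀ u : List A, u.length = n →
    (OccursInfinitely x u → ∀ i, OccursWithin x u i l) ∧
    (¬ OccursInfinitely x u → ∀ i, l ≤ i → ¬ OccursAt x u i)}

/-- The almost periodicity regulator `r_x(n)`: the least element of `regulatorSet x n`, which is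
nonempty for every generalized almost periodic `x` over a finite alphabet (see
`regulatorSet_nonempty`). -/
noncomputable def regulator (x : ℕ → A) (n : ℕ) : ℕ := sInf (regulatorSet x n)

/-- `x` is linearly almost periodic: almost periodic with `r_x(n) ≤ C n` for some `C ≥ 1`. -/
def IsLinearlyAP (x : ℕ → A) : Prop :=
  IsAP x ∧ ∃ C : ℝ, 1 ≤ C ∧ ∀ n : ℕ, (regulator x n : ℝ) ≤ C * n

/-- `x` is eventually linearly almost periodic: some suffix is linearly almost periodic. -/
def IsEventuallyLinearlyAP (x : ℕ → A) : Prop := ∃ k, IsLinearlyAP (suffix x k)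

theorem OccursWithin.mono {x : ℕ → A} {u : List A} {i l l' : ℕ} (h : OccursWithin x u i l)
    (hl : l ≤ l') : OccursWithin x u i l' := by
  obtain ⟨j, h1, h2, h3⟩ := h
  exact ⟨j, h1, by omega, h3⟩

theorem IsAP.isGAP {x : ℕ → A} (h : IsAP x) : IsGAP x :=
  fun u hu hinf => h u hu hinf.nonempty

theorem regulatorSet_nonempty [Finite A] {x : ℕ → A} (hx : IsGAP x) (n : ℕ) :
    (regulatorSet x n).Nonempty := by
  have key : ∀ u : List A, ∃ l,
      (OccursInfinitely x u → ∀ i, OccursWithin x u i l) ∧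
      (¬ OccursInfinitely x u → ∀ i, l ≤ i → ¬ OccursAt x u i) := by
    intro u
    by_cases hinf : OccursInfinitely x u
    · by_cases hu : u = []
      · subst hu
        exact ⟨0, fun _ i => ⟨i, le_rfl, by simp, by simp [OccursAt, factor]⟩,
          fun h => absurd hinf h⟩
      · obtain ⟨l, hl⟩ := hx u hu hinf
        exact ⟨l, fun _ => hl, fun h => absurd hinf h⟩
    · obtain ⟨b, hb⟩ := (Set.not_infinite.mp hinf).bddAbove
      refine ⟨b + 1, fun h => absurd h hinf, fun _ i hi ho => ?_⟩
      have : i ≤ b := hb ho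
      omega
  choose f hf using key
  have hfin : {u : List A | u.length = n}.Finite := List.finite_length_eq A n
  obtain ⟨b, hb⟩ := (hfin.image f).bddAbove
  refine ⟨b, fun u hu => ?_⟩
  have hub : f u ≤ b := hb ⟨u, hu, rfl⟩
  exact ⟨fun h i => ((hf u).1 h i).mono hub, fun h i hi => (hf u).2 h i (hub.trans hi)⟩

end Sequences

/-- A (deterministic, letter-to-word) finite-state transducer with input alphabet `A`, output
alphabet `B` and set of states `Q`; finiteness of these is assumed where it is used. -/
structure Transducer (A B Q : Type*) where
  /-- the initial state -/
  start : Q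
  /-- the output function `λ : Q × A → B*` -/
  out : Q → A → List B
  /-- the transition function `μ : Q × A → Q` -/
  next : Q → A → Q

namespace Transducer

variable {A B Q : Type*} (M : Transducer A B Q)

/-- The run of `M` on `x`. -/
def run (x : ℕ → A) : ℕ → Q
  | 0 => M.start
  | n + 1 => M.next (run x n) (x n)

/-- The concatenation of the words output by `M` on the first `n` letters of `x`. -/
def outPrefix (x : ℕ → A) : ℕ → List B
  | 0 => []
  | n + 1 => outPrefix x n ++ M.out (M.run x n) (x n)

/-- `M` outputs infinitely many letters on `x`, so that `M(x)` is an infinite sequence. -/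
def InfiniteImage (x : ℕ → A) : Prop := ∀ i, ∃ n, i < (M.outPrefix x n).length

/-- The image `M(x)`: the infinite concatenation of the words output along the run. Its `i`-th
letter is read off the first output prefix that is long enough. -/
def image (x : ℕ → A) (h : M.InfiniteImage x) : ℕ → B := fun i =>
  (M.outPrefix x (Nat.find (h i)))[i]'(Nat.find_spec (h i))

/-- `M` is uniform: every transition outputs exactly one letter. -/
def IsUniform : Prop := ∀ q a, (M.out q a).length = 1

theorem outPrefix_isPrefix (x : ℕ → A) {n n' : ℕ} (h : n ≤ n') :
    M.outPrefix x n <+: M.outPrefix x n' := by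
  induction h with
  | refl => exact List.prefix_rfl
  | step _ ih => exact ih.trans (List.prefix_append _ _)

theorem image_eq (x : ℕ → A) (h : M.InfiniteImage x) (n i : ℕ)
    (hi : i < (M.outPrefix x n).length) : M.image x h i = (M.outPrefix x n)[i] :=
  (M.outPrefix_isPrefix x (Nat.find_min' (h i) hi)).getElem (Nat.find_spec (h i))

theorem IsUniform.infiniteImage {M : Transducer A B Q} (hM : M.IsUniform) (x : ℕ → A) :
    M.InfiniteImage x := by
  have hlen : ∀ n, (M.outPrefix x n).length = n := by
    intro n
    induction n with
    | zero => rfl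
    | succ n ih => simp [outPrefix, ih, hM _ _]
  exact fun i => ⟨i + 1, by simp [hlen]⟩

end Transducer

end AlmostPeriodic

/-! Let `y` be the almost periodic suffix, `p` the states of the run along it, and `m` the number of
states. It suffices to show that the pairs `(y, p)` recur with a linear bound from some early
position on (`exists_recursWithin_run`); outputs are then read off them.

Return times (`exists_hit_within`): suppose a word `u` is read in state `q` infinitely often. Call a
state good for a word `w` if reading `w` from it meets `u` in state `q`. If some occurrence of `w`
is read from a bad state, an extension of `w` of length `r |w| + 1` has more good states. Starting
from `u`, fewer than `m` extensions give a word all of whose occurrences contain a hit. Iterating `s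
↦ C s + 1` yields the bound.

Start of recurrence (`IsMinRank.mem_recurrentStates`): some short word merges states as much as any
of its extensions does. Beyond it transitions are injective on the reachable states, so no state
seen after it can be transient.

Each part costs at most `m` iterations, and the second only shifts the start, so exponent `m`
already suffices in place of `2m`. -/

namespace AlmostPeriodic

/-! ### Recurrence of factors and the regulator. -/

section Agreement

variable {A B : Type*}

/-- The factors of `x` of length `n` at positions `i` and `j` coincide. -/
def Agree (x : ℕ → A) (i j n : ℕ) : Prop := ∀ d < n, x (i + d) = x (j + d)

theorem Agree.refl (x : ℕ → A) (i n : ℕ) : Agree x i i n := fun _ _ => rfl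

theorem Agree.trans {x : ℕ → A} {i j k n : ℕ} (h : Agree x i j n) (h' : Agree x j k n) :
    Agree x i k n :=
  fun d hd => (h d hd).trans (h' d hd)

theorem Agree.mono {x : ℕ → A} {i j n n' : ℕ} (h : Agree x i j n) (hn : n' ≤ n) :
    Agree x i j n' :=
  fun d hd => h d (hd.trans_le hn)

theorem Agree.sub {x : ℕ → A} {i j n n' : ℕ} (h : Agree x i j n) (e : ℕ) (hn : e + n' ≤ n) :
    Agree x (i + e) (j + e) n' := by
  intro d hd
  have := h (e + d) (by omega)
  simpa only [add_assoc] using this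

theorem Agree.map {x : ℕ → A} {i j n : ℕ} (g : A → B) (h : Agree x i j n) :
    Agree (fun i => g (x i)) i j n :=
  fun d hd => congrArg g (h d hd)

theorem agree_iff_factor_eq {x : ℕ → A} {i j n : ℕ} :
    Agree x i j n ↔ factor x j n = factor x i n := by
  unfold factor
  rw [List.ofFn_inj, funext_iff]
  exact ⟨fun h d => (h d d.2).symm, fun h d hd => (h ⟨d, hd⟩).symm⟩

theorem factor_length (x : ℕ → A) (i n : ℕ) : (factor x i n).length = n := by
  simp [factor]

theorem occursAt_factor_iff {x : ℕ → A} {i j n : ℕ} :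
    OccursAt x (factor x i n) j ↔ Agree x i j n := by
  rw [agree_iff_factor_eq, OccursAt, factor_length]

theorem occursWithin_factor_iff {x : ℕ → A} {i n j l : ℕ} :
    OccursWithin x (factor x i n) j l ↔ ∃ j', j ≤ j' ∧ j' + n ≤ j + l ∧ Agree x i j' n := by
  simp only [OccursWithin, factor_length, occursAt_factor_iff]

/-- Every factor of `x` of length `n` that occurs at a position `≥ L` occurs inside every segment
of length `b n`. -/
def RecursWithin (x : ℕ → A) (L : ℕ) (b : ℕ → ℕ) : Prop :=
  ∀ n i j, L ≤ i → ∃ j', j ≤ j' ∧ j' + n ≤ j + b n ∧ Agree x i j' n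

theorem RecursWithin.map {x : ℕ → A} {L : ℕ} {b : ℕ → ℕ} (h : RecursWithin x L b) (g : A → B) :
    RecursWithin (fun i => g (x i)) L b := by
  intro n i j hi
  obtain ⟨j', h1, h2, h3⟩ := h n i j hi
  exact ⟨j', h1, h2, h3.map g⟩

theorem RecursWithin.suffix {x : ℕ → A} {L : ℕ} {b : ℕ → ℕ} (h : RecursWithin x L b) :
    RecursWithin (suffix x L) 0 b := by
  intro n i j _
  obtain ⟨j', h1, h2, h3⟩ := h n (L + i) (L + j) (by omega)
  refine ⟨j' - L, by omega, by omega, fun d hd => ?_⟩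
  have := h3 d hd
  simp only [AlmostPeriodic.suffix]
  rw [← add_assoc, this]
  congr 1
  omega

theorem RecursWithin.occursInfinitely {x : ℕ → A} {L : ℕ} {b : ℕ → ℕ} (h : RecursWithin x L b)
    {i : ℕ} (hi : L ≤ i) (n : ℕ) : OccursInfinitely x (factor x i n) := by
  refine Set.infinite_of_forall_exists_gt fun N => ?_
  obtain ⟨j', h1, -, h3⟩ := h n i (N + 1) hi
  exact ⟨j', occursAt_factor_iff.2 h3, by omega⟩

theorem RecursWithin.occursWithin {x : ℕ → A} {L : ℕ} {b : ℕ → ℕ} (h : RecursWithin x L b)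
    {u : List A} (hu : OccursInfinitely x u) (j : ℕ) : OccursWithin x u j (b u.length) := by
  obtain ⟨i, hi, hL⟩ := hu.exists_gt L
  have hi' : factor x i u.length = u := hi
  have := occursWithin_factor_iff.2 (h u.length i j hL.le)
  rwa [hi'] at this

theorem RecursWithin.isGAP {x : ℕ → A} {L : ℕ} {b : ℕ → ℕ} (h : RecursWithin x L b) :
    IsGAP x :=
  fun u _ hu => ⟨b u.length, h.occursWithin hu⟩

theorem RecursWithin.isAP {x : ℕ → A} {b : ℕ → ℕ} (h : RecursWithin x 0 b) : IsAP x := by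
  rintro u - ⟨i, hi⟩
  have hi' : factor x i u.length = u := hi
  refine ⟨b u.length, h.occursWithin ?_⟩
  rw [← hi']
  exact h.occursInfinitely (Nat.zero_le _) _

/-- A word occurring at a position `≥ L` occurs infinitely often, so `L ≤ b n` takes care of the
clause on words that occur finitely often. -/
theorem RecursWithin.regulator_le {x : ℕ → A} {L : ℕ} {b : ℕ → ℕ} (h : RecursWithin x L b)
    {n : ℕ} (hL : L ≤ b n) : regulator x n ≤ b n := by
  refine Nat.sInf_le ?_
  rintro u rfl
  refine ⟨fun hu => h.occursWithin hu, fun hu i hi ho => hu ?_⟩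
  have hi' : factor x i u.length = u := ho
  rw [← hi']
  exact h.occursInfinitely (hL.trans hi) _

/-- Needed because a bound `c * n + d` can be absorbed into `C * n` only for `n > 0`. -/
theorem regulator_zero (x : ℕ → A) : regulator x 0 = 0 := by
  refine Nat.le_zero.1 (Nat.sInf_le ?_)
  intro u hu
  have hocc : ∀ i, OccursAt x u i := by
    intro i
    rw [List.length_eq_zero_iff] at hu
    subst hu
    simp [OccursAt, factor]
  refine ⟨fun _ i => ⟨i, le_rfl, by omega, hocc i⟩, fun h => absurd ?_ h⟩
  exact Set.infinite_of_forall_exists_gt fun N => ⟨N + 1, hocc _, by omega⟩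

theorem IsAP.recursWithin [Finite A] {x : ℕ → A} (h : IsAP x) :
    RecursWithin x 0 (regulator x) := by
  intro n i j _
  rcases Nat.eq_zero_or_pos n with rfl | hn
  · exact ⟨j, le_rfl, by omega, fun d hd => absurd hd (Nat.not_lt_zero d)⟩
  · have hmem : regulator x n ∈ regulatorSet x n :=
      Nat.sInf_mem (regulatorSet_nonempty h.isGAP n)
    refine occursWithin_factor_iff.1 ((hmem _ (factor_length x i n)).1 ?_ j)
    have hne : factor x i n ≠ [] := by
      intro h0
      have := factor_length x i n
      rw [h0, List.length_nil] at this
      omega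
    obtain ⟨l, hl⟩ := h _ hne ⟨i, occursAt_factor_iff.2 (Agree.refl x i n)⟩
    refine Set.infinite_of_forall_exists_gt fun N => ?_
    obtain ⟨j', h1, -, h3⟩ := hl (N + 1)
    exact ⟨j', h3, by omega⟩

theorem RecursWithin.isLinearlyAP {x : ℕ → A} {b : ℕ → ℕ} (h : RecursWithin x 0 b) {c d : ℕ}
    (hb : ∀ n, b n ≤ c * n + d) : IsLinearlyAP x := by
  refine ⟨h.isAP, c + d + 1, by have := Nat.cast_nonneg (α := ℝ) c; have := Nat.cast_nonneg (α := ℝ) d; linarith, fun n => ?_⟩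
  rcases Nat.eq_zero_or_pos n with rfl | hn
  · simp [regulator_zero]
  · have h1 : regulator x n ≤ (c + d + 1) * n := by
      have := (h.regulator_le (n := n) (Nat.zero_le _)).trans (hb n)
      nlinarith
    exact_mod_cast h1

end Agreement

/-! ### The iterated length bound. -/

section Bound

/-- The `t`-th iterate of `s ↦ C s + 1` at `n`. -/
noncomputable def lengthBound (C : ℝ) (t n : ℕ) : ℝ := C ^ t * n + ∑ i ∈ Finset.range t, C ^ i

theorem lengthBound_zero (C : ℝ) (n : ℕ) : lengthBound C 0 n = n := by simp [lengthBound]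

theorem lengthBound_succ (C : ℝ) (t n : ℕ) :
    lengthBound C (t + 1) n = C * lengthBound C t n + 1 := by
  simp only [lengthBound, geom_sum_succ]
  ring

theorem lengthBound_nonneg {C : ℝ} (hC : 1 ≤ C) (t n : ℕ) : 0 ≤ lengthBound C t n := by
  unfold lengthBound
  have : 0 ≤ C := by linarith
  positivity

theorem lengthBound_mono_left {C : ℝ} (hC : 1 ≤ C) (n : ℕ) :
    Monotone fun t => lengthBound C t n := by
  refine monotone_nat_of_le_succ fun t => ?_
  rw [lengthBound_succ]
  nlinarith [lengthBound_nonneg hC t n]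

theorem lengthBound_mono_right {C : ℝ} (hC : 1 ≤ C) (t : ℕ) :
    Monotone fun n => lengthBound C t n := by
  intro n n' h
  have : 0 ≤ C := by linarith
  simp only [lengthBound]
  gcongr

end Bound

/-! ### Runs of an automaton: return times of a word read in a given state. -/

section Runs

variable {A Q : Type*} (δ : Q → A → Q) (y : ℕ → A)

/-- The state reached from `s` by reading `y(i) ⋯ y(i+d-1)`. -/
def readFrom (i : ℕ) : ℕ → Q → Q
  | 0, s => s
  | d + 1, s => δ (readFrom i d s) (y (i + d))

theorem readFrom_add (i a b : ℕ) (s : Q) :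
    readFrom δ y i (a + b) s = readFrom δ y (i + a) b (readFrom δ y i a s) := by
  induction b with
  | zero => rfl
  | succ b ih => rw [← add_assoc, readFrom, readFrom, ih, add_assoc]

variable {δ y}

theorem Agree.readFrom_eq {i j n : ℕ} (h : Agree y i j n) {d : ℕ} (hd : d ≤ n) (s : Q) :
    readFrom δ y i d s = readFrom δ y j d s := by
  induction d with
  | zero => rfl
  | succ d ih => rw [readFrom, readFrom, ih (by omega), h d (by omega)]

variable {p : ℕ → Q}

theorem readFrom_run (hp : ∀ i, p (i + 1) = δ (p i) (y i)) (i d : ℕ) :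
    readFrom δ y i d (p i) = p (i + d) := by
  induction d with
  | zero => rfl
  | succ d ih => rw [readFrom, ih, ← add_assoc, hp]

variable (δ y) in
/-- The states from which the word at `i₀` of length `n` is read in state `q` somewhere inside the
segment of length `l` at `h`. -/
def hitSet (i₀ n : ℕ) (q : Q) (h l : ℕ) : Set Q :=
  {s | ∃ d, d + n ≤ l ∧ Agree y i₀ (h + d) n ∧ readFrom δ y h d s = q}

theorem hitSet_mono (i₀ n : ℕ) (q : Q) (h : ℕ) {l l' : ℕ} (hl : l ≤ l') :
    hitSet δ y i₀ n q h l ⊆ hitSet δ y i₀ n q h l' :=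
  fun _ ⟨d, h1, h2⟩ => ⟨d, h1.trans hl, h2⟩

theorem Agree.hitSet_subset {i₀ n : ℕ} {q : Q} {h h' l : ℕ} (ha : Agree y h h' l) :
    hitSet δ y i₀ n q h l ⊆ hitSet δ y i₀ n q h' l := by
  rintro s ⟨d, h1, h2, h3⟩
  exact ⟨d, h1, h2.trans (ha.sub d h1), by rw [← h3, ha.readFrom_eq (by omega)]⟩

theorem run_mem_hitSet_iff (hp : ∀ i, p (i + 1) = δ (p i) (y i)) {i₀ n : ℕ} {q : Q} {h l : ℕ} :
    p h ∈ hitSet δ y i₀ n q h l ↔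
      ∃ j, h ≤ j ∧ j + n ≤ h + l ∧ Agree y i₀ j n ∧ p j = q := by
  simp only [hitSet, Set.mem_ofPred_eq, readFrom_run hp]
  constructor
  · rintro ⟨d, h1, h2⟩
    exact ⟨h + d, by omega, by omega, h2⟩
  · rintro ⟨j, h1, h2, h3⟩
    refine ⟨j - h, by omega, ?_⟩
    rwa [Nat.add_sub_cancel' h1]

/-- If the segment at `h` is once read without a hit, then a slightly longer segment
starting with it has a strictly larger hit set. -/
theorem exists_hitSet_ssubset (hp : ∀ i, p (i + 1) = δ (p i) (y i)) {r : ℕ → ℕ}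
    (hr : RecursWithin y 0 r) {i₀ n : ℕ} {q : Q}
    (hinf : ∀ N, ∃ j, N ≤ j ∧ Agree y i₀ j n ∧ p j = q) {h l h₁ : ℕ} (hn : n ≤ l)
    (ha : Agree y h h₁ l) (hbad : p h₁ ∉ hitSet δ y i₀ n q h₁ l) :
    ∃ h', l ≤ r l + 1 ∧ hitSet δ y i₀ n q h l ⊂ hitSet δ y i₀ n q h' (r l + 1) := by
  have hlr : l ≤ r l := by
    obtain ⟨j', h1, h2, -⟩ := hr l 0 0 le_rfl
    omega
  have key : ∃ h', Agree y h h' l ∧ p h' ∉ hitSet δ y i₀ n q h' l ∧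
      p h' ∈ hitSet δ y i₀ n q h' (r l + 1) := by
    by_contra! hcon
    -- If no bad occurrence gains a hit when extended, bad occurrences follow one another forever
    -- and hits stop after `h₁`, against `hinf`.
    have chain : ∀ N, ∃ h', h₁ + N ≤ h' ∧ Agree y h h' l ∧ p h' ∉ hitSet δ y i₀ n q h' l ∧
        ∀ j, h₁ ≤ j → j < h' → ¬ (Agree y i₀ j n ∧ p j = q) := by
      intro N
      induction N with
      | zero => exact ⟨h₁, le_rfl, ha, hbad, fun j h1 h2 => by omega⟩
      | succ N ih =>
        obtain ⟨h', h1, h2, h3, h4⟩ := ih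
        have h5 := hcon h' h2 h3
        rw [run_mem_hitSet_iff hp] at h5
        push Not at h5
        -- The next occurrence lies inside the hit-free segment of length `r l + 1` at `h'`, hence
        -- is bad too; the `+ 1` forces it to start after `h'`.
        obtain ⟨h'', g1, g2, g3⟩ := hr l h (h' + 1) (Nat.zero_le _)
        refine ⟨h'', by omega, g3, fun hmem => ?_, fun j j1 j2 hj => ?_⟩
        · obtain ⟨j, j1, j2, j3, j4⟩ := (run_mem_hitSet_iff hp).1 hmem
          exact h5 j (by omega) (by omega) j3 j4
        · by_cases hj' : j < h'
          · exact h4 j j1 hj' hj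
          · exact h5 j (by omega) (by omega) hj.1 hj.2
    obtain ⟨j, j1, j2⟩ := hinf h₁
    obtain ⟨h', h1, -, -, h4⟩ := chain (j + 1)
    exact h4 j j1 (by omega) j2
  obtain ⟨h', h1, h2, h3⟩ := key
  refine ⟨h', by omega, ?_⟩
  rw [Set.ssubset_iff_of_subset (h1.hitSet_subset.trans (hitSet_mono _ _ _ _ (by omega)))]
  exact ⟨p h', h3, fun hmem => h2 (h1.hitSet_subset hmem)⟩

/-- A word that is read infinitely often in state `q` is read in state `q` inside every segment
of linear length. -/
theorem exists_hit_within [Finite Q] (hp : ∀ i, p (i + 1) = δ (p i) (y i)) {r : ℕ → ℕ}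
    (hr : RecursWithin y 0 r) {C : ℝ} (hC : 1 ≤ C) (hrC : ∀ n, (r n : ℝ) ≤ C * n) {i₀ n : ℕ}
    {q : Q} (hinf : ∀ N, ∃ j, N ≤ j ∧ Agree y i₀ j n ∧ p j = q) (j : ℕ) :
    ∃ j', j ≤ j' ∧ j' + n ≤ j + ⌊lengthBound C (Nat.card Q) n⌋₊ ∧ Agree y i₀ j' n ∧ p j' = q := by
  have key : ∀ t, ∃ h l, n ≤ l ∧ (l : ℝ) ≤ lengthBound C t n ∧
      ((∀ h₁, Agree y h h₁ l → p h₁ ∈ hitSet δ y i₀ n q h₁ l) ∨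
        t + 1 ≤ (hitSet δ y i₀ n q h l).ncard) := by
    intro t
    induction t with
    | zero =>
      -- The word itself, read from `q`, is a hit at offset `0`.
      refine ⟨i₀, n, le_rfl, by rw [lengthBound_zero], Or.inr ?_⟩
      rw [zero_add, Nat.succ_le_iff, Set.ncard_pos]
      exact ⟨q, 0, by omega, Agree.refl _ _ _, rfl⟩
    | succ t ih =>
      obtain ⟨h, l, h1, h2, h3⟩ := ih
      by_cases hg : ∀ h₁, Agree y h h₁ l → p h₁ ∈ hitSet δ y i₀ n q h₁ l
      · exact ⟨h, l, h1, h2.trans (lengthBound_mono_left hC n (Nat.le_succ t)), Or.inl hg⟩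
      · have h4 := h3.resolve_left hg
        push Not at hg
        obtain ⟨h₁, ha, hbad⟩ := hg
        obtain ⟨h', h5, h6⟩ := exists_hitSet_ssubset hp hr hinf h1 ha hbad
        refine ⟨h', r l + 1, by omega, ?_, Or.inr ?_⟩
        · rw [lengthBound_succ]
          push_cast
          nlinarith [hrC l]
        · have := Set.ncard_lt_ncard h6 (Set.toFinite _)
          omega
  have hQ : 0 < Nat.card Q := Nat.card_pos_iff.2 ⟨⟨q⟩, inferInstance⟩
  -- After `Nat.card Q - 1` steps every state is good; the last factor `C` pays for finding the word
  -- inside an arbitrary segment.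
  obtain ⟨h, l, h1, h2, h3⟩ := key (Nat.card Q - 1)
  have hgood : ∀ h₁, Agree y h h₁ l → p h₁ ∈ hitSet δ y i₀ n q h₁ l := by
    rcases h3 with h3 | h3
    · exact h3
    · intro h₁ ha
      refine ha.hitSet_subset ?_
      have : hitSet δ y i₀ n q h l = Set.univ :=
        Set.eq_of_subset_of_ncard_le (Set.subset_univ _)
          (by rw [Set.ncard_univ]; omega) (Set.toFinite _)
      rw [this]
      trivial
  have hfloor : r l ≤ ⌊lengthBound C (Nat.card Q) n⌋₊ := by
    refine Nat.le_floor ?_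
    have : Nat.card Q = Nat.card Q - 1 + 1 := by omega
    rw [this, lengthBound_succ]
    nlinarith [hrC l]
  obtain ⟨h₁, g1, g2, g3⟩ := hr l h j (Nat.zero_le _)
  obtain ⟨j', k1, k2, k3⟩ := (run_mem_hitSet_iff hp).1 (hgood h₁ g3)
  exact ⟨j', by omega, by omega, k3⟩

/-! ### Words of minimal rank. -/

variable (δ y) in
/-- The states that can be reached by reading the segment of length `l` at `h`. -/
def reachSet (h l : ℕ) : Set Q := Set.range (readFrom δ y h l)

theorem Agree.reachSet_eq {h h' l : ℕ} (ha : Agree y h h' l) :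
    reachSet δ y h l = reachSet δ y h' l :=
  congrArg Set.range (funext fun s => ha.readFrom_eq le_rfl s)

theorem reachSet_add (h a b : ℕ) :
    reachSet δ y h (a + b) = readFrom δ y (h + a) b '' reachSet δ y h a := by
  rw [reachSet, reachSet, ← Set.range_comp]
  exact congrArg Set.range (funext fun s => readFrom_add δ y h a b s)

theorem reachSet_add_subset (h a b : ℕ) :
    reachSet δ y h (a + b) ⊆ reachSet δ y (h + a) b := by
  rw [reachSet_add]
  exact Set.image_subset_range _ _

theorem ncard_reachSet_anti [Finite Q] (h : ℕ) {l l' : ℕ} (hl : l ≤ l') :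
    (reachSet δ y h l').ncard ≤ (reachSet δ y h l).ncard := by
  obtain ⟨b, rfl⟩ := Nat.exists_eq_add_of_le hl
  rw [reachSet_add]
  exact Set.ncard_image_le (Set.toFinite _)

theorem run_mem_reachSet (hp : ∀ i, p (i + 1) = δ (p i) (y i)) (h l : ℕ) :
    p (h + l) ∈ reachSet δ y h l :=
  ⟨p h, readFrom_run hp h l⟩

variable (δ y) in
/-- No right extension of the segment of length `l` at `h` merges further states. -/
def IsMinRank (h l : ℕ) : Prop :=
  ∀ h' l', Agree y h h' l → l ≤ l' → (reachSet δ y h l).ncard ≤ (reachSet δ y h' l').ncard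

/-- Rank needs checking only up to the next return of the word. There the reachable set lies in that
of the word and, having lost no element, equals it; so the same set reappears at return after
return, arbitrarily far out. -/
theorem isMinRank_of_returns [Finite Q] {r : ℕ → ℕ} (hr : RecursWithin y 0 r) {h l : ℕ}
    (hret : ∀ h', Agree y h h' l →
      (reachSet δ y h l).ncard ≤ (reachSet δ y h' (r l + 1)).ncard) :
    IsMinRank δ y h l := by
  intro h' l' ha _
  have chain : ∀ N, ∃ e, N ≤ e ∧ Agree y h (h' + e) l ∧
      reachSet δ y h' (e + l) = reachSet δ y h l := by
    intro N
    induction N with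
    | zero => exact ⟨0, le_rfl, ha, by rw [zero_add, ha.reachSet_eq]⟩
    | succ N ih =>
      obtain ⟨e, h1, h2, h3⟩ := ih
      obtain ⟨h'', g1, g2, g3⟩ := hr l h (h' + e + 1) (Nat.zero_le _)
      obtain ⟨f, rfl⟩ := Nat.exists_eq_add_of_le (show h' + e ≤ h'' by omega)
      refine ⟨e + f, by omega, by rwa [← add_assoc], ?_⟩
      have e1 : reachSet δ y (h' + e) (f + l) = reachSet δ y h l := by
        refine Set.eq_of_subset_of_ncard_le ?_ ?_ (Set.toFinite _)
        · rw [g3.reachSet_eq]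
          exact reachSet_add_subset _ _ _
        · exact (hret _ h2).trans (ncard_reachSet_anti _ (by omega))
      have e2 : reachSet δ y h' (e + f + l) = reachSet δ y (h' + e) (f + l) := by
        rw [show e + f + l = e + l + f by omega, show f + l = l + f by omega, reachSet_add,
          reachSet_add _ l f, h3, h2.reachSet_eq, add_assoc]
      rw [e2, e1]
  obtain ⟨e, h1, -, h3⟩ := chain l'
  rw [← h3]
  exact ncard_reachSet_anti _ (by omega)

/-- Begin with the empty word. While the rank is not minimal, some word of length `r l + 1` has
smaller rank, and rank `1` is minimal. -/
theorem exists_isMinRank [Finite Q] [Nonempty Q] {r : ℕ → ℕ} (hr : RecursWithin y 0 r) {C : ℝ}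
    (hC : 1 ≤ C) (hrC : ∀ n, (r n : ℝ) ≤ C * n) :
    ∃ h l, IsMinRank δ y h l ∧ (r l : ℝ) ≤ lengthBound C (Nat.card Q) 0 := by
  have hQ : 0 < Nat.card Q := Nat.card_pos
  have key : ∀ t, ∃ h l : ℕ, (l : ℝ) ≤ lengthBound C t 0 ∧
      (IsMinRank δ y h l ∨ (reachSet δ y h l).ncard + t ≤ Nat.card Q) := by
    intro t
    induction t with
    | zero => exact ⟨0, 0, by simp [lengthBound_zero], Or.inr (Set.ncard_le_card _)⟩
    | succ t ih =>
      obtain ⟨h, l, h1, h2⟩ := ih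
      by_cases hm : IsMinRank δ y h l
      · exact ⟨h, l, h1.trans (lengthBound_mono_left hC 0 (Nat.le_succ t)), Or.inl hm⟩
      · have h3 := h2.resolve_left hm
        have : ∃ h', Agree y h h' l ∧
            (reachSet δ y h' (r l + 1)).ncard < (reachSet δ y h l).ncard := by
          by_contra! hcon
          exact hm (isMinRank_of_returns hr hcon)
        obtain ⟨h', -, h4⟩ := this
        refine ⟨h', r l + 1, ?_, Or.inr (by omega)⟩
        rw [lengthBound_succ]
        push_cast
        nlinarith [hrC l]
  obtain ⟨h, l, h1, h2⟩ := key (Nat.card Q - 1)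
  have hne : ∀ h' l', 1 ≤ (reachSet δ y h' l').ncard := by
    intro h' l'
    rw [Nat.succ_le_iff, Set.ncard_pos]
    exact Set.range_nonempty _
  refine ⟨h, l, ?_, ?_⟩
  · rcases h2 with h2 | h2
    · exact h2
    · intro h' l' _ _
      have := hne h' l'
      omega
  · have : Nat.card Q = Nat.card Q - 1 + 1 := by omega
    rw [this, lengthBound_succ]
    nlinarith [hrC l]

theorem IsMinRank.injOn [Finite Q] {h l : ℕ} (hm : IsMinRank δ y h l) {h' : ℕ}
    (ha : Agree y h h' l) (b : ℕ) :
    Set.InjOn (readFrom δ y (h' + l) b) (reachSet δ y h l) := by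
  refine Set.injOn_of_ncard_image_eq (le_antisymm (Set.ncard_image_le (Set.toFinite _)) ?_)
    (Set.toFinite _)
  have := hm h' (l + b) ha (by omega)
  rwa [reachSet_add, ← ha.reachSet_eq] at this

/-! ### Recurrence of the run after a word of minimal rank. -/

variable (y p) in
/-- The states that occur infinitely often after the first `l` letters of an occurrence of the
word of length `l'` at `e`. -/
def recurrentStates (l e l' : ℕ) : Set Q :=
  {s | ∀ N, ∃ h, N ≤ h ∧ Agree y e h l' ∧ p (h + l) = s}

/-- Pigeonhole: the word occurs infinitely often and there are finitely many states. -/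
theorem recurrentStates_nonempty [Finite Q] {r : ℕ → ℕ} (hr : RecursWithin y 0 r)
    (l e l' : ℕ) : (recurrentStates y p l e l').Nonempty := by
  by_contra hempty
  rw [Set.not_nonempty_iff_eq_empty, Set.eq_empty_iff_forall_notMem] at hempty
  simp only [recurrentStates, Set.mem_ofPred_eq] at hempty
  push Not at hempty
  choose N hN using hempty
  obtain ⟨b, hb⟩ := (Set.finite_range N).bddAbove
  obtain ⟨h, h1, -, h3⟩ := hr l' e b (Nat.zero_le _)
  exact hN (p (h + l)) h ((hb ⟨_, rfl⟩).trans h1) h3 rfl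

/-- After an occurrence of a word of minimal rank the run of the automaton is recurrent. -/
theorem IsMinRank.mem_recurrentStates [Finite Q] (hp : ∀ i, p (i + 1) = δ (p i) (y i))
    {r : ℕ → ℕ} (hr : RecursWithin y 0 r) {h l : ℕ} (hm : IsMinRank δ y h l) {h₀ l₀ : ℕ}
    (ha : Agree y h h₀ l) (hl₀ : l ≤ l₀) : p (h₀ + l) ∈ recurrentStates y p l h₀ l₀ := by
  have hex : ∃ c e l', l ≤ l' ∧ Agree y h e l ∧ (recurrentStates y p l e l').ncard = c :=
    ⟨_, h₀, l₀, hl₀, ha, rfl⟩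
  -- Among all extensions of the minimal-rank word, take one with the fewest recurrent states.
  obtain ⟨e, l', hl', he, hmin⟩ : ∃ e l', l ≤ l' ∧ Agree y h e l ∧
      ∀ e₁ l₁, l ≤ l₁ → Agree y h e₁ l →
        (recurrentStates y p l e l').ncard ≤ (recurrentStates y p l e₁ l₁).ncard := by
    classical
    obtain ⟨e, l', h1, h2, h3⟩ := Nat.find_spec hex
    refine ⟨e, l', h1, h2, fun e₁ l₁ h4 h5 => ?_⟩
    rw [h3]
    exact Nat.find_min' hex ⟨e₁, l₁, h4, h5, rfl⟩
  obtain ⟨s₀, hs₀⟩ := recurrentStates_nonempty (p := p) hr l e l'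
  -- The run itself reaches the recurrent state `s₀` at a later occurrence of that extension, far
  -- enough for `f ≥ l₀`.
  obtain ⟨e₂, h1, h2, h3⟩ := hs₀ (h₀ + l₀)
  obtain ⟨f, rfl⟩ := Nat.exists_eq_add_of_le (show h₀ ≤ e₂ by omega)
  have hread : ∀ i, readFrom δ y (i + l) f (p (i + l)) = p (i + f + l) := by
    intro i
    rw [readFrom_run hp]
    congr 1
    omega
  have hsub : readFrom δ y (h₀ + l) f '' recurrentStates y p l h₀ (f + l') ⊆
      recurrentStates y p l e l' := by
    rintro _ ⟨s, hs, rfl⟩ N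
    obtain ⟨h₁, g1, g2, g3⟩ := hs N
    refine ⟨h₁ + f, by omega, h2.trans (g2.sub f le_rfl), ?_⟩
    rw [← hread, g3]
    exact ((g2.sub l (n' := f) (by omega)).readFrom_eq le_rfl s).symm
  have hreach : recurrentStates y p l h₀ (f + l') ⊆ reachSet δ y h l := by
    intro s hs
    obtain ⟨h₁, -, g2, g3⟩ := hs 0
    rw [(ha.trans (g2.mono (by omega))).reachSet_eq, ← g3]
    exact run_mem_reachSet hp h₁ l
  -- Minimal rank makes the map injective and minimality of the count makes it onto. So `s₀` has a
  -- recurrent preimage, which injectivity identifies with `p (h₀ + l)`.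
  have heq : readFrom δ y (h₀ + l) f '' recurrentStates y p l h₀ (f + l') =
      recurrentStates y p l e l' := by
    refine Set.eq_of_subset_of_ncard_le hsub ?_ (Set.toFinite _)
    rw [((hm.injOn ha f).mono hreach).ncard_image]
    exact hmin _ _ (by omega) ha
  rw [← heq] at hs₀
  obtain ⟨s, hs, hs'⟩ := hs₀
  have hst : s = p (h₀ + l) := by
    refine hm.injOn ha f (hreach hs) ?_ ?_
    · rw [ha.reachSet_eq]
      exact run_mem_reachSet hp h₀ l
    · rw [hs', hread, h3]
  intro N
  obtain ⟨h₁, g1, g2, g3⟩ := hs N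
  exact ⟨h₁, g1, g2.mono (by omega), g3.trans hst⟩

/-- The sequence of input letters and states of an automaton reading a linearly almost periodic
sequence. -/
theorem exists_recursWithin_run [Finite Q] (hp : ∀ i, p (i + 1) = δ (p i) (y i)) {r : ℕ → ℕ}
    (hr : RecursWithin y 0 r) {C : ℝ} (hC : 1 ≤ C) (hrC : ∀ n, (r n : ℝ) ≤ C * n) :
    ∃ L ≤ ⌊lengthBound C (Nat.card Q) 0⌋₊,
      RecursWithin (fun i => (y i, p i)) L fun n => ⌊lengthBound C (Nat.card Q) n⌋₊ := by
  have : Nonempty Q := ⟨p 0⟩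
  obtain ⟨h, l, hm, hl⟩ := exists_isMinRank (δ := δ) hr hC hrC
  -- The minimal-rank word ends within the first `r l` letters, which bounds `L`.
  obtain ⟨h₀, -, h2, h3⟩ := hr l h 0 (Nat.zero_le _)
  refine ⟨h₀ + l, ?_, fun n i j hi => ?_⟩
  · have := Nat.le_floor hl
    omega
  · have hinf : ∀ N, ∃ j, N ≤ j ∧ Agree y i j n ∧ p j = p i := by
      intro N
      obtain ⟨f, rfl⟩ := Nat.exists_eq_add_of_le hi
      -- Take the word from `h₀` up to `i + n`: whenever it recurs with the same state after `l`
      -- letters, the state at the position matching `i` is `p i`.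
      obtain ⟨h₁, g1, g2, g3⟩ :=
        hm.mem_recurrentStates hp hr h3 (show l ≤ l + f + n by omega) N
      refine ⟨h₁ + l + f, by omega, ?_, ?_⟩
      · have := g2.sub (l + f) le_rfl
        simpa only [← add_assoc] using this
      · rw [← readFrom_run hp (h₁ + l) f, ← readFrom_run hp (h₀ + l) f, g3]
        exact ((g2.sub l (n' := f) (by omega)).readFrom_eq le_rfl _).symm
    obtain ⟨j', g1, g2, g3, g4⟩ := exists_hit_within hp hr hC hrC hinf j
    refine ⟨j', g1, g2, fun d hd => Prod.ext (g3 d hd) ?_⟩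
    change p (i + d) = p (j' + d)
    rw [← readFrom_run hp i d, ← readFrom_run hp j' d, g4]
    exact g3.readFrom_eq hd.le _

end Runs

/-! ### Passing to suffixes. -/

section Suffix

variable {A : Type*}

theorem agree_suffix_iff {x : ℕ → A} {k i j n : ℕ} :
    Agree (suffix x k) i j n ↔ Agree x (k + i) (k + j) n := by
  simp only [Agree, suffix, add_assoc]

theorem suffix_suffix (x : ℕ → A) (k l : ℕ) : suffix (suffix x k) l = suffix x (k + l) := by
  funext i
  simp only [suffix, add_assoc]

theorem recursWithin_suffix_iff {x : ℕ → A} {k : ℕ} {b : ℕ → ℕ} :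
    RecursWithin (suffix x k) 0 b ↔
      ∀ n i j, k ≤ i → k ≤ j → ∃ j', j ≤ j' ∧ j' + n ≤ j + b n ∧ Agree x i j' n := by
  constructor
  · intro h n i j hi hj
    obtain ⟨i, rfl⟩ := Nat.exists_eq_add_of_le hi
    obtain ⟨j, rfl⟩ := Nat.exists_eq_add_of_le hj
    obtain ⟨j', h1, h2, h3⟩ := h n i j (Nat.zero_le _)
    exact ⟨k + j', by omega, by omega, agree_suffix_iff.1 h3⟩
  · intro h n i j _
    obtain ⟨j', h1, h2, h3⟩ := h n (k + i) (k + j) (by omega) (by omega)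
    obtain ⟨j', rfl⟩ := Nat.exists_eq_add_of_le (show k ≤ j' by omega)
    exact ⟨j', by omega, by omega, agree_suffix_iff.2 h3⟩

theorem factor_succ (x : ℕ → A) (i n : ℕ) : factor x i (n + 1) = factor x i n ++ [x (i + n)] := by
  simp only [factor, List.ofFn_succ', List.concat_eq_append]
  rfl

end Suffix

/-! ### From recurrence of the trace to recurrence of the image. -/

namespace Transducer

variable {A B Q : Type*} (M : Transducer A B Q) (x : ℕ → A)

/-- The input letter and the state of `M` at each step. -/
def trace (i : ℕ) : A × Q := (x i, M.run x i)

/-- The word output on a word of letters and states. -/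
def outWord (w : List (A × Q)) : List B := (w.map fun s => M.out s.2 s.1).flatten

/-- The number of letters output in the first `n` steps. -/
def outLength (n : ℕ) : ℕ := (M.outPrefix x n).length

theorem outPrefix_add (a d : ℕ) :
    M.outPrefix x (a + d) = M.outPrefix x a ++ M.outWord (factor (M.trace x) a d) := by
  induction d with
  | zero => simp [factor, outWord]
  | succ d ih =>
    rw [← add_assoc, outPrefix, ih, factor_succ]
    simp [outWord, trace]

theorem outLength_add (a d : ℕ) :
    M.outLength x (a + d) = M.outLength x a + (M.outWord (factor (M.trace x) a d)).length := by
  rw [outLength, outPrefix_add, List.length_append, outLength]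

theorem outLength_mono : Monotone (M.outLength x) :=
  fun _ _ h => (M.outPrefix_isPrefix x h).length_le

theorem some_image (h : M.InfiniteImage x) (a d f : ℕ)
    (hf : f < (M.outWord (factor (M.trace x) a d)).length) :
    some (M.image x h (M.outLength x a + f)) = (M.outWord (factor (M.trace x) a d))[f]? := by
  have hlt : M.outLength x a + f < (M.outPrefix x (a + d)).length := by
    have := M.outLength_add x a d
    simp only [outLength] at this ⊢
    omega
  rw [M.image_eq x h _ _ hlt, ← List.getElem?_eq_getElem hlt, outPrefix_add,
    List.getElem?_append_right (by simp [outLength])]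
  simp [outLength]

variable {M x}

theorem _root_.AlmostPeriodic.Agree.image {a a' d : ℕ} (ha : Agree (M.trace x) a a' d)
    (h : M.InfiniteImage x) :
    Agree (M.image x h) (M.outLength x a) (M.outLength x a')
      (M.outLength x (a + d) - M.outLength x a) := by
  intro f hf
  have hlen := M.outLength_add x a d
  have heq := agree_iff_factor_eq.1 ha
  refine Option.some_injective _ ?_
  rw [M.some_image x h a d f (by omega), M.some_image x h a' d f (by rw [heq]; omega), heq]

theorem exists_out_length_le [Finite A] [Finite Q] (M : Transducer A B Q) (x : ℕ → A) :
    ∃ K, ∀ a d, M.outLength x (a + d) ≤ M.outLength x a + K * d := by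
  obtain ⟨K, hK⟩ := (Set.finite_range fun s : A × Q => (M.out s.2 s.1).length).bddAbove
  refine ⟨K, fun a d => ?_⟩
  induction d with
  | zero => simp
  | succ d ih =>
    have h1 : (M.out (M.run x (a + d)) (x (a + d))).length ≤ K :=
      hK ⟨(x (a + d), M.run x (a + d)), rfl⟩
    have h2 : M.outLength x (a + (d + 1)) =
        M.outLength x (a + d) + (M.out (M.run x (a + d)) (x (a + d))).length := by
      rw [← add_assoc, outLength, outPrefix, List.length_append, outLength]
    rw [h2, Nat.mul_succ]
    omega

/-- The output grows at least linearly along a recurrent run. -/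
theorem add_le_outLength (h : M.InfiniteImage x) {k : ℕ} {b : ℕ → ℕ}
    (hz : RecursWithin (suffix (M.trace x) k) 0 b) {a : ℕ} (ha : k ≤ a) (n : ℕ) :
    M.outLength x a + n ≤ M.outLength x (a + b 1 * n) := by
  rw [recursWithin_suffix_iff] at hz
  -- Some step after `k` emits a letter; its letter-state pair recurs in every `b 1` steps, so each
  -- such block emits one.
  obtain ⟨c, hc, hlt⟩ : ∃ c, k ≤ c ∧ M.outLength x c < M.outLength x (c + 1) := by
    by_contra! hcon
    have hconst : ∀ d, M.outLength x (k + d) ≤ M.outLength x k := by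
      intro d
      induction d with
      | zero => exact le_rfl
      | succ d ih => exact (hcon (k + d) (by omega)).trans ih
    obtain ⟨n, hn⟩ := h (M.outLength x k)
    have h1 : M.outLength x n ≤ M.outLength x (k + n) := M.outLength_mono x (by omega)
    have h2 := hconst n
    simp only [outLength] at h1 h2 hn
    omega
  have hstep : ∀ a, k ≤ a → M.outLength x a + 1 ≤ M.outLength x (a + b 1) := by
    intro a ha
    obtain ⟨j', h1, h2, h3⟩ := hz 1 c a hc ha
    have h4 := M.outLength_add x c 1
    have h5 := M.outLength_add x j' 1
    rw [agree_iff_factor_eq.1 h3] at h5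
    have h6 := M.outLength_mono x h1
    have h7 := M.outLength_mono x h2
    omega
  induction n with
  | zero => exact le_rfl
  | succ n ih =>
    have := hstep (a + b 1 * n) (by omega)
    rw [Nat.mul_succ, ← add_assoc a]
    omega

theorem exists_outLength_le_lt (h : M.InfiniteImage x) {k i : ℕ} (hi : M.outLength x k ≤ i) :
    ∃ a, k ≤ a ∧ M.outLength x a ≤ i ∧ i < M.outLength x (a + 1) := by
  classical
  have hex : ∃ a, i < M.outLength x (k + a + 1) := by
    obtain ⟨n, hn⟩ := h i
    exact ⟨n, lt_of_lt_of_le hn (M.outLength_mono x (by omega))⟩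
  refine ⟨k + Nat.find hex, by omega, ?_, Nat.find_spec hex⟩
  rcases hf : Nat.find hex with _ | a
  · exact hi
  · have := Nat.find_min hex (m := a) (by omega)
    exact not_lt.1 this

/-- Output length and number of steps are linearly comparable: a step emits at most `K` letters, and
`b 1 * n` steps emit at least `n`. -/
theorem exists_recursWithin_image [Finite A] [Finite Q] (h : M.InfiniteImage x) {k : ℕ}
    {b : ℕ → ℕ} (hz : RecursWithin (suffix (M.trace x) k) 0 b) :
    ∃ K D, RecursWithin (suffix (M.image x h) (M.outLength x k)) 0
      fun n => K * (1 + b (1 + D * n)) := by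
  obtain ⟨K, hK⟩ := M.exists_out_length_le x
  refine ⟨K, b 1, recursWithin_suffix_iff.2 fun n i j hi hj => ?_⟩
  obtain ⟨a, ha, hai, hai'⟩ := exists_outLength_le_lt h hi
  obtain ⟨c, hc, hcj, hcj'⟩ := exists_outLength_le_lt h hj
  -- Step `a` emits letter `i`, and the next `b 1 * n` steps cover the rest of the factor. Searching
  -- from `c + 1` places the copy after `j`; the extra step accounts for the `1 +` in the bound.
  obtain ⟨c', g1, g2, g3⟩ :=
    recursWithin_suffix_iff.1 hz (1 + b 1 * n) a (c + 1) ha (by omega)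
  obtain ⟨e, rfl⟩ := Nat.exists_eq_add_of_le hai
  have h1 := add_le_outLength h hz (show k ≤ a + 1 by omega) n
  rw [add_assoc] at h1
  have h2 := M.outLength_add x a (1 + b 1 * n)
  have h3 := M.outLength_add x c' (1 + b 1 * n)
  rw [agree_iff_factor_eq.1 g3] at h3
  have h4 := M.outLength_mono x g1
  have h5 := M.outLength_mono x g2
  have h6 := hK c (1 + b (1 + b 1 * n))
  rw [← add_assoc] at h6
  refine ⟨M.outLength x c' + e, by omega, by omega, (g3.image h).sub e (by omega)⟩

theorem IsUniform.image_eq_getElem (hM : M.IsUniform) (h : M.InfiniteImage x) (i : ℕ) :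
    M.image x h i = (M.out (M.run x i) (x i))[0]'(by rw [hM]; exact Nat.one_pos) := by
  have hlen : ∀ n, M.outLength x n = n := by
    intro n
    induction n with
    | zero => rfl
    | succ n ih =>
      rw [outLength, outPrefix, List.length_append, hM]
      simpa [outLength] using ih
  have hw : M.outWord (factor (M.trace x) i 1) = M.out (M.run x i) (x i) := by
    simp [outWord, factor, trace]
  have := M.some_image x h i 1 0 (by rw [hw, hM]; exact Nat.one_pos)
  rw [hw, hlen, List.getElem?_eq_getElem (by rw [hM]; exact Nat.one_pos)] at this
  exact Option.some_injective _ this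

/-- From step `k` on, the run reads the suffix, only from another initial state. -/
theorem exists_recursWithin_trace [Finite A] [Finite Q] (M : Transducer A B Q) {x : ℕ → A}
    {k : ℕ} {C : ℝ} (hC : 1 ≤ C) (hx : IsAP (suffix x k))
    (hr : ∀ n : ℕ, (regulator (suffix x k) n : ℝ) ≤ C * n) :
    ∃ L ≤ ⌊lengthBound C (Nat.card Q) 0⌋₊,
      RecursWithin (suffix (M.trace x) k) L fun n => ⌊lengthBound C (Nat.card Q) n⌋₊ :=
  exists_recursWithin_run (δ := M.next) (p := fun i => M.run x (k + i)) (fun _ => rfl)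
    hx.recursWithin hC hr

theorem isEventuallyLinearlyAP_image [Finite A] [Finite Q] (h : M.InfiniteImage x)
    (hx : IsEventuallyLinearlyAP x) : IsEventuallyLinearlyAP (M.image x h) := by
  obtain ⟨k, hap, C, hC, hr⟩ := hx
  obtain ⟨L, -, hL⟩ := M.exists_recursWithin_trace hC hap hr
  have hz := hL.suffix
  rw [suffix_suffix] at hz
  obtain ⟨K, D, hKD⟩ := exists_recursWithin_image h hz
  obtain ⟨c, hc⟩ : ∃ c : ℕ, ∀ n, ⌊lengthBound C (Nat.card Q) n⌋₊ ≤ c * n + c := by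
    obtain ⟨c₁, h1⟩ := exists_nat_ge (C ^ Nat.card Q)
    obtain ⟨c₂, h2⟩ := exists_nat_ge (∑ i ∈ Finset.range (Nat.card Q), C ^ i)
    refine ⟨c₁ + c₂, fun n => Nat.floor_le_of_le ?_⟩
    have hn : (0 : ℝ) ≤ n := Nat.cast_nonneg n
    have hc₁ : (0 : ℝ) ≤ c₁ := Nat.cast_nonneg c₁
    have hc₂ : (0 : ℝ) ≤ c₂ := Nat.cast_nonneg c₂
    push_cast
    simp only [lengthBound]
    nlinarith [mul_le_mul_of_nonneg_right h1 hn, mul_nonneg hc₂ hn]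
  refine ⟨_, hKD.isLinearlyAP (c := K * (c * D)) (d := K * (1 + 2 * c)) fun n => ?_⟩
  calc K * (1 + ⌊lengthBound C (Nat.card Q) (1 + D * n)⌋₊)
      ≤ K * (1 + (c * (1 + D * n) + c)) := by gcongr; exact hc _
    _ = K * (c * D) * n + K * (1 + 2 * c) := by ring

theorem IsUniform.regulator_image_le [Finite A] [Finite Q] (hM : M.IsUniform)
    (h : M.InfiniteImage x) {C : ℝ} {k : ℕ} (hC : 1 ≤ C) (hx : IsAP (suffix x k))
    (hr : ∀ n : ℕ, (regulator (suffix x k) n : ℝ) ≤ C * n) :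
    IsGAP (suffix (M.image x h) k) ∧
    (∀ n : ℕ, (regulator (suffix (M.image x h) k) n : ℝ) ≤ lengthBound C (Nat.card Q) n) ∧
    ∃ k' : ℕ, k ≤ k' ∧ IsAP (suffix (M.image x h) k') ∧
      ∀ n : ℕ, (regulator (suffix (M.image x h) k') n : ℝ) ≤ lengthBound C (Nat.card Q) n := by
  obtain ⟨L, hL, hrec⟩ := M.exists_recursWithin_trace hC hx hr
  have himage : suffix (M.image x h) k = fun i =>
      (fun s : A × Q => (M.out s.2 s.1)[0]'(by rw [hM]; exact Nat.one_pos))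
        (suffix (M.trace x) k i) :=
    funext fun i => hM.image_eq_getElem h (k + i)
  -- A uniform image is a letter-to-letter image of the trace, so no constant is lost.
  have hw := hrec.map fun s : A × Q => (M.out s.2 s.1)[0]'(by rw [hM]; exact Nat.one_pos)
  rw [← himage] at hw
  have hfloor : ∀ n : ℕ, (⌊lengthBound C (Nat.card Q) n⌋₊ : ℝ) ≤ lengthBound C (Nat.card Q) n :=
    fun n => Nat.floor_le (lengthBound_nonneg hC _ n)
  have hLn : ∀ n, L ≤ ⌊lengthBound C (Nat.card Q) n⌋₊ := fun n =>
    hL.trans (Nat.floor_le_floor (lengthBound_mono_right hC _ (Nat.zero_le n)))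
  refine ⟨hw.isGAP, fun n => (Nat.cast_le.2 (hw.regulator_le (hLn n))).trans (hfloor n),
    k + L, Nat.le_add_right _ _, ?_⟩
  rw [← suffix_suffix]
  exact ⟨hw.suffix.isAP, fun n =>
    (Nat.cast_le.2 (hw.suffix.regulator_le (Nat.zero_le _))).trans (hfloor n)⟩

end Transducer

end AlmostPeriodic

theorem mainTheorem7 {A B Q : Type*} [Finite A] [Finite B] [Finite Q]
    (M : AlmostPeriodic.Transducer A B Q) (x : ℕ → A) (hM : M.InfiniteImage x)
    (hx : AlmostPeriodic.IsEventuallyLinearlyAP x) :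
    AlmostPeriodic.IsEventuallyLinearlyAP (M.image x hM) ∧
    (M.IsUniform → ∀ (C : ℝ) (k : ℕ), 1 ≤ C →
      AlmostPeriodic.IsAP (AlmostPeriodic.suffix x k) →
      (∀ n : ℕ, (AlmostPeriodic.regulator (AlmostPeriodic.suffix x k) n : ℝ) ≤ C * n) →
      AlmostPeriodic.IsGAP (AlmostPeriodic.suffix (M.image x hM) k) ∧
      (∀ n : ℕ, (AlmostPeriodic.regulator (AlmostPeriodic.suffix (M.image x hM) k) n : ℝ) ≤
        C ^ (2 * Nat.card Q) * n + ∑ i ∈ Finset.range (2 * Nat.card Q), C ^ i) ∧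
      ∃ k' : ℕ, k ≤ k' ∧ AlmostPeriodic.IsAP (AlmostPeriodic.suffix (M.image x hM) k') ∧
        ∀ n : ℕ, (AlmostPeriodic.regulator (AlmostPeriodic.suffix (M.image x hM) k') n : ℝ) ≤
          C ^ (2 * Nat.card Q) * n + ∑ i ∈ Finset.range (2 * Nat.card Q), C ^ i) := by
  refine ⟨AlmostPeriodic.Transducer.isEventuallyLinearlyAP_image hM hx,
    fun hU C k hC hap hr => ?_⟩
  -- The exponent `m` is weakened to `2m`, which is harmless as `C ≥ 1`.
  have hbound : ∀ n : ℕ, AlmostPeriodic.lengthBound C (Nat.card Q) n ≤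
      C ^ (2 * Nat.card Q) * n + ∑ i ∈ Finset.range (2 * Nat.card Q), C ^ i :=
    fun n => AlmostPeriodic.lengthBound_mono_left hC n (by omega)
  obtain ⟨h1, h2, k', h3, h4, h5⟩ := hU.regulator_image_le hM hC hap hr
  exact ⟨h1, fun n => (h2 n).trans (hbound n), k', h3, h4, fun n => (h5 n).trans (hbound n)⟩
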